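/- Let $d \ge 2$ and let $G$ be the free group on $e_1,\dots,e_d$. Let $\xi_1,\xi_2,\dots$ be independent random variables, each uniformly distributed on the $2d$ letters $e_1^{\pm1},\dots,e_d^{\pm1}$. Let $T_n$ be the number of turns in the reduced word $a_1\cdots a_k$ (each $a_j$ a letter) of $\xi_1\xi_2\cdots\xi_n\in G$, that is, the number of indices $1\le j\le k-1$ with $a_j\neq a_{j+1}$. Put $$h(\theta)=\begin{cases}\dfrac1{2d}\left[2(d-1)e^{\theta}+\dfrac{2d-1}{1+2(d-1)e^{\theta}}+1\right], & \theta\ge \log\dfrac{\sqrt{2d-1}-1}{2(d-1)},\\[2ex] \dfrac{\sqrt{2d-1}}{d}, & \theta<\log\dfrac{\sqrt{2d-1}-1}{2(d-1)},\end{cases}$$ and $I(x)=\sup_{\theta\in\mathbb R}\,[\theta x-\log h(\theta)]\in(-\infty,\infty]$ for $x\in\mathbb R$. Then the laws of $T_n/n$, $n\ge1$, satisfy the large deviations principle on $\mathbb R$ (with speed $n$) with rate function $I$. That is, $I$ is nonnegative and lower semicontinuous, and for every Borel set $\Gamma\subseteq\mathbb R$, $$-\inf_{x\in\Gamma^{\circ}}I(x)\le\liminf_{n\to\infty}\frac1n\log\mathbb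 P\left(\frac{T_n}{n}\in\Gamma\right)\le\limsup_{n\to\infty}\frac1n\log\mathbb P\left(\frac{T_n}{n}\in\Gamma\right)\le-\inf_{x\in\overline\Gamma}I(x),$$ where $\Gamma^{\circ}$ and $\overline\Gamma$ are the interior and closure of $\Gamma$, $\log 0=-\infty$ and $\inf\emptyset=+\infty$. -/

import Mathlib

open MeasureTheory ProbabilityTheory
open scoped ENNReal

namespace ReducedWalk

/-- A letter `(i, b)` stands for the generator `e i` if `b = true` and for its inverse
`(e i)⁻¹` if `b = false`. This is the corresponding element of the free group. -/
def letter {d : ℕ} (a : Fin d × Bool) : FreeGroup (Fin d) := FreeGroup.mk [a]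

/-- The position at time `n` of the path in the free group that starts at the empty word and is
multiplied on the right by the letters `a 0, a 1, a 2, …`. -/
def walk {d : ℕ} (a : ℕ → Fin d × Bool) : ℕ → FreeGroup (Fin d)
  | 0 => 1
  | n + 1 => walk a n * letter (a n)

/-- The number of turns of a list of letters: the number of places at which two consecutive
letters are different. -/
def listTurns {d : ℕ} (w : List (Fin d × Bool)) : ℕ :=
  (w.zip w.tail).countP fun p => p.1 ≠ p.2

/-- The number of turns in the reduced word of the product of the first `n` letters. -/
def turns {d : ℕ} (a : ℕ → Fin d × Bool) (n : ℕ) : ℕ :=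
  listTurns (walk a n).toWord

/-- The sequence of measures `μ` satisfies the large deviations principle (with speed `n`) with
rate function `I`: the function `I` takes values in `[0, ∞]` and is lower semicontinuous, and for
every measurable set `Γ`,
`-inf_{int Γ} I ≤ liminf (1/n) log (μ n Γ) ≤ limsup (1/n) log (μ n Γ) ≤ -inf_{cl Γ} I`.
Here `ExpGrowth.expGrowthInf u` is `liminf log (u n) / n` and `ExpGrowth.expGrowthSup u` is
`limsup log (u n) / n`, where `log 0 = -∞`. -/
structure SatisfiesLDP {X : Type*} [TopologicalSpace X] [MeasurableSpace X]
    (μ : ℕ → Measure X) (I : X → EReal) : Prop where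
  nonneg : ∀ x, 0 ≤ I x
  lowerSemicontinuous : LowerSemicontinuous I
  lower_bound : ∀ Γ : Set X, MeasurableSet Γ →
    -(⨅ x ∈ interior Γ, I x) ≤ ExpGrowth.expGrowthInf fun n => μ n Γ
  upper_bound : ∀ Γ : Set X, MeasurableSet Γ →
    ExpGrowth.expGrowthSup (fun n => μ n Γ) ≤ -(⨅ x ∈ closure Γ, I x)

/-- The piecewise function `h`. -/
noncomputable def h (d : ℕ) (θ : ℝ) : ℝ :=
  if Real.log ((√(2 * d - 1) - 1) / (2 * (d - 1))) ≤ θ then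
    1 / (2 * d) * (2 * (d - 1) * Real.exp θ
      + (2 * d - 1) / (1 + 2 * (d - 1) * Real.exp θ) + 1)
  else √(2 * d - 1) / d

/-- The rate function `I(x) = sup_θ [θ x - log h(θ)]`, with values in the extended reals. -/
noncomputable def rate (d : ℕ) (x : ℝ) : EReal :=
  ⨆ θ : ℝ, ((θ * x - Real.log (h d θ) : ℝ) : EReal)

end ReducedWalk

/-! ### Letters and averaging operators -/

namespace ReducedWalk

open Filter Topology

/-! By the Gärtner–Ellis method it suffices to control the moments `E exp(θ T_n)`. Reversing the
letters does not change the law of the product, so letters may be multiplied on the left, where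
cancellation only touches the head of the reduced word (`rightAverage_iterate_one`). Let `Q` be the
averaging operator of this walk, and sum a function `f` over the reduced words of each length `k`.
The sums of `Q f` depend only on those of `f`, through a tridiagonal recursion in `k`. For `f =
exp(θ · turns)` the sums are `2d u^(k-1)`, `k ≥ 1`, with `u = 1 + 2(d-1)e^θ`.

With `uv = 2d - 1`, the sequences `u^k` and `v^k` solve the recursion at lengths at least 2 with
eigenvalue `(u + v)/(2d)`, which is `h(θ)` when `u ≥ √(2d-1)`. Combinations of them, corrected at
lengths 0 and 1, are super- and subsolutions, so the moments are comparable to `h(θ)^n` when `u >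
√(2d-1)`. Below the threshold only the upper bound is needed, and monotonicity in `θ` gives it.

In the range `u > √(2d-1)` the derivative of `log h` takes every value in `(0, 1)`
(`exists_logGrowthSlope_mem`), which yields the local lower bounds. The endpoints 0 and 1 are
approximated by nearby slopes, and outside `[0, 1]` the rate is infinite. -/

/-- The letter inverse to a given one. -/
def invLetter {d : ℕ} (a : Fin d × Bool) : Fin d × Bool := (a.1, !a.2)

@[simp]
theorem invLetter_invLetter {d : ℕ} (a : Fin d × Bool) : invLetter (invLetter a) = a := by
  simp [invLetter]

theorem invLetter_ne {d : ℕ} (a : Fin d × Bool) : invLetter a ≠ a := by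
  intro h
  simpa [invLetter] using congrArg Prod.snd h

theorem eq_invLetter_comm {d : ℕ} {a b : Fin d × Bool} : a = invLetter b ↔ b = invLetter a := by
  constructor <;> rintro rfl <;> simp

/-- Multiplication of a reduced word by a letter on the left. -/
def push {d : ℕ} (a : Fin d × Bool) : List (Fin d × Bool) → List (Fin d × Bool)
  | [] => [a]
  | b :: l => if a = invLetter b then l else a :: b :: l

theorem toWord_letter_mul {d : ℕ} (a : Fin d × Bool) (g : FreeGroup (Fin d)) :
    (letter a * g).toWord = push a g.toWord := by
  have h1 : (letter a).toWord = [a] := FreeGroup.reduce_singleton a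
  rw [FreeGroup.toWord_mul, h1, List.singleton_append, FreeGroup.reduce.cons,
    FreeGroup.reduce_toWord]
  cases g.toWord with
  | nil => rfl
  | cons b l => simp [push, invLetter, Prod.ext_iff]

/-- The transition operator of the walk that is multiplied by letters on the left, on functions of
the reduced word. -/
noncomputable def wordAverage {d : ℕ} (f : List (Fin d × Bool) → ℝ) (l : List (Fin d × Bool)) : ℝ :=
  (2 * d : ℝ)⁻¹ * ∑ a, f (push a l)

/-- The transition operator of the walk that is multiplied by letters on the right. -/
noncomputable def rightAverage {d : ℕ} (f : FreeGroup (Fin d) → ℝ) (g : FreeGroup (Fin d)) : ℝ :=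
  (2 * d : ℝ)⁻¹ * ∑ a, f (g * letter a)

/-- The transition operator of the walk that is multiplied by letters on the left. -/
noncomputable def leftAverage {d : ℕ} (f : FreeGroup (Fin d) → ℝ) (g : FreeGroup (Fin d)) : ℝ :=
  (2 * d : ℝ)⁻¹ * ∑ a, f (letter a * g)

theorem commute_rightAverage_leftAverage {d : ℕ} :
    Function.Commute (rightAverage (d := d)) leftAverage := by
  intro f
  funext g
  simp only [rightAverage, leftAverage, ← Finset.mul_sum]
  rw [Finset.sum_comm]
  simp only [mul_assoc]

/-- The two averages commute and agree at the identity, so right factors can be traded for left ones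
one at a time. -/
theorem rightAverage_iterate_one {d : ℕ} (n : ℕ) (f : FreeGroup (Fin d) → ℝ) :
    rightAverage^[n] f 1 = leftAverage^[n] f 1 := by
  induction n generalizing f with
  | zero => rfl
  | succ n ih =>
    rw [Function.iterate_succ_apply, ih, Function.iterate_succ_apply',
      ← (commute_rightAverage_leftAverage.iterate_right n).eq]
    simp [rightAverage, leftAverage]

theorem leftAverage_iterate_toWord {d : ℕ} (n : ℕ) (f : List (Fin d × Bool) → ℝ)
    (g : FreeGroup (Fin d)) :
    leftAverage^[n] (fun g => f g.toWord) g = wordAverage^[n] f g.toWord := by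
  induction n generalizing g with
  | zero => rfl
  | succ n ih =>
    rw [Function.iterate_succ_apply', Function.iterate_succ_apply']
    simp [leftAverage, wordAverage, ih, toWord_letter_mul]

/-! ### Sphere sums and their recursion -/

/-- The sum of a function over the reduced words of length `k + 1` with first letter `b`. -/
noncomputable def cylinderSum {d : ℕ} :
    ℕ → (Fin d × Bool) → (List (Fin d × Bool) → ℝ) →ₗ[ℝ] ℝ
  | 0, b => LinearMap.proj [b]
  | k + 1, b => ∑ c with c ≠ invLetter b, cylinderSum k c ∘ₗ LinearMap.funLeft ℝ ℝ (List.cons b)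

theorem cylinderSum_zero {d : ℕ} (b : Fin d × Bool) (f : List (Fin d × Bool) → ℝ) :
    cylinderSum 0 b f = f [b] := rfl

theorem cylinderSum_succ {d : ℕ} (k : ℕ) (b : Fin d × Bool) (f : List (Fin d × Bool) → ℝ) :
    cylinderSum (k + 1) b f = ∑ c with c ≠ invLetter b, cylinderSum k c fun l => f (b :: l) := by
  simp only [cylinderSum, LinearMap.sum_apply, LinearMap.comp_apply]
  rfl

theorem cylinderSum_congr {d : ℕ} (k : ℕ) (b : Fin d × Bool) {f g : List (Fin d × Bool) → ℝ}
    (h : ∀ l, f (b :: l) = g (b :: l)) : cylinderSum k b f = cylinderSum k b g := by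
  cases k with
  | zero => exact h []
  | succ k => simp only [cylinderSum_succ, h]

/-- The sum of a function over the reduced words of length `k`. -/
noncomputable def sphereSum {d : ℕ} (f : List (Fin d × Bool) → ℝ) : ℕ → ℝ
  | 0 => f []
  | k + 1 => ∑ b, cylinderSum k b f

theorem card_letters_ne {d : ℕ} (a : Fin d × Bool) :
    ((Finset.univ.filter fun b => b ≠ a).card : ℝ) = 2 * d - 1 := by
  rw [Finset.filter_ne', Finset.card_erase_of_mem (Finset.mem_univ a), Finset.card_univ]
  have : 0 < Fintype.card (Fin d × Bool) := Fintype.card_pos_iff.2 ⟨a⟩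
  rw [Nat.cast_sub this]
  simp [mul_comm]

theorem sphereSum_wordAverage_zero {d : ℕ} (f : List (Fin d × Bool) → ℝ) :
    sphereSum (wordAverage f) 0 = (2 * d : ℝ)⁻¹ * sphereSum f 1 := rfl

/-- Exactly one letter cancels the head `b`; every other letter lengthens the word. -/
theorem cylinderSum_wordAverage {d : ℕ} (k : ℕ) (b : Fin d × Bool)
    (f : List (Fin d × Bool) → ℝ) :
    cylinderSum k b (wordAverage f) = (2 * d : ℝ)⁻¹ *
      (cylinderSum k b (fun l => f l.tail) +
        ∑ a with a ≠ invLetter b, cylinderSum k b fun l => f (a :: l)) := by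
  rw [← map_sum, ← map_add, ← smul_eq_mul, ← map_smul]
  apply cylinderSum_congr
  intro l
  simp only [wordAverage, Pi.smul_apply, Pi.add_apply, smul_eq_mul, List.tail_cons,
    Finset.sum_apply]
  congr 1
  rw [← Finset.sum_filter_add_sum_filter_not Finset.univ (fun a => a = invLetter b)]
  congr 1
  · rw [Finset.filter_eq' Finset.univ, if_pos (Finset.mem_univ _), Finset.sum_singleton]
    simp [push]
  · refine Finset.sum_congr rfl fun a ha => ?_
    rw [push, if_neg (Finset.mem_filter.1 ha).2]

theorem sum_sum_ne_invLetter {d : ℕ} (F : Fin d × Bool → Fin d × Bool → ℝ) :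
    ∑ b, ∑ a with a ≠ invLetter b, F a b = ∑ a, ∑ b with b ≠ invLetter a, F a b := by
  simp only [Finset.sum_filter]
  rw [Finset.sum_comm]
  simp only [ne_eq, eq_invLetter_comm]

theorem sphereSum_wordAverage_succ {d : ℕ} (k : ℕ) (f : List (Fin d × Bool) → ℝ) :
    sphereSum (wordAverage f) (k + 1) = (2 * d : ℝ)⁻¹ *
      (∑ b, cylinderSum k b (fun l => f l.tail) + sphereSum f (k + 2)) := by
  simp only [sphereSum, cylinderSum_wordAverage, ← Finset.mul_sum, Finset.sum_add_distrib]
  rw [sum_sum_ne_invLetter]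
  simp only [cylinderSum_succ]

theorem sphereSum_wordAverage_one {d : ℕ} (f : List (Fin d × Bool) → ℝ) :
    sphereSum (wordAverage f) 1 = (2 * d : ℝ)⁻¹ * (2 * d * sphereSum f 0 + sphereSum f 2) := by
  rw [sphereSum_wordAverage_succ]
  simp [cylinderSum_zero, sphereSum, mul_comm]

/-- A nonempty reduced word is the tail of `2d - 1` reduced words, but `[]` is the tail of all `2d`
one-letter words; hence the separate equation at length 1. -/
theorem sphereSum_wordAverage_add_two {d : ℕ} (k : ℕ) (f : List (Fin d × Bool) → ℝ) :
    sphereSum (wordAverage f) (k + 2) = (2 * d : ℝ)⁻¹ *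
      ((2 * d - 1) * sphereSum f (k + 1) + sphereSum f (k + 3)) := by
  rw [sphereSum_wordAverage_succ]
  congr 2
  simp only [cylinderSum_succ, List.tail_cons]
  rw [← sum_sum_ne_invLetter fun _ b => cylinderSum k b f]
  simp only [Finset.sum_const, nsmul_eq_mul, card_letters_ne, sphereSum, Finset.mul_sum]

/-! ### Exponential weights of turns -/

theorem listTurns_cons_cons {d : ℕ} (b c : Fin d × Bool) (l : List (Fin d × Bool)) :
    listTurns (b :: c :: l) = (if b = c then 0 else 1) + listTurns (c :: l) := by
  simp only [listTurns, List.tail_cons, List.zip_cons_cons, List.countP_cons]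
  split_ifs <;> simp_all [add_comm]

theorem listTurns_le_length {d : ℕ} (l : List (Fin d × Bool)) : listTurns l ≤ l.length := by
  refine List.countP_le_length.trans ?_
  simp

/-- The exponential weight of the turns of a word. -/
noncomputable def turnWeight {d : ℕ} (θ : ℝ) (l : List (Fin d × Bool)) : ℝ :=
  Real.exp (θ * listTurns l)

theorem sum_weight_ne_invLetter {d : ℕ} (b : Fin d × Bool) (r : ℝ) :
    (∑ c with c ≠ invLetter b, if b = c then (1 : ℝ) else r) = 1 + 2 * (d - 1) * r := by
  have h : ∀ c, (if b = c then (1 : ℝ) else r) = r + (if b = c then 1 - r else 0) := by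
    intro c; split_ifs <;> ring
  simp only [h, Finset.sum_add_distrib, Finset.sum_const, nsmul_eq_mul, card_letters_ne]
  rw [Finset.sum_ite_eq, if_pos (by simp [(invLetter_ne b).symm])]
  ring

/-- A letter may be followed by itself, with weight 1, or by one of `2(d-1)` letters that make a
turn, with weight `exp θ`. The total does not depend on the letter. -/
theorem cylinderSum_turnWeight {d : ℕ} (θ : ℝ) (k : ℕ) (b : Fin d × Bool) :
    cylinderSum k b (turnWeight θ) = (1 + 2 * (d - 1) * Real.exp θ) ^ k := by
  induction k generalizing b with
  | zero => simp [cylinderSum_zero, turnWeight, listTurns]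
  | succ k ih =>
    have h : ∀ c, cylinderSum k c (fun l => turnWeight θ (b :: l)) =
        (if b = c then 1 else Real.exp θ) * (1 + 2 * (d - 1) * Real.exp θ) ^ k := by
      intro c
      rw [← ih c, ← smul_eq_mul, ← map_smul]
      apply cylinderSum_congr
      intro l
      simp only [turnWeight, listTurns_cons_cons, Pi.smul_apply, smul_eq_mul]
      split_ifs <;> simp [mul_add, Real.exp_add]
    simp only [cylinderSum_succ, h, ← Finset.sum_mul, sum_weight_ne_invLetter]
    ring

theorem sphereSum_turnWeight_succ {d : ℕ} (θ : ℝ) (k : ℕ) :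
    sphereSum (turnWeight (d := d) θ) (k + 1) =
      2 * d * (1 + 2 * (d - 1) * Real.exp θ) ^ k := by
  simp [sphereSum, cylinderSum_turnWeight, mul_comm]

/-! ### Comparison with sub- and supersolutions -/

section Comparison

variable {d : ℕ} {f : List (Fin d × Bool) → ℝ} {p : ℕ → ℝ} {H : ℝ}

/-- The recursion has nonnegative coefficients, so it preserves order. No sign is required of `p`,
which lets the upper bound follow by negation. -/
theorem pow_mul_le_sphereSum (hd : 2 ≤ d) (hH : 0 ≤ H) (hf : ∀ k, p k ≤ sphereSum f k)
    (h0 : 2 * d * (H * p 0) ≤ p 1) (h1 : 2 * d * (H * p 1) ≤ 2 * d * p 0 + p 2)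
    (h2 : ∀ k, 2 * d * (H * p (k + 2)) ≤ (2 * d - 1) * p (k + 1) + p (k + 3)) (n k : ℕ) :
    H ^ n * p k ≤ sphereSum (wordAverage^[n] f) k := by
  have hd' : (2 : ℝ) ≤ d := by exact_mod_cast hd
  induction n generalizing k with
  | zero => simpa using hf k
  | succ n ih =>
    have key : ∀ {x y z : ℝ}, 2 * d * (H * x) ≤ y → H ^ n * y ≤ z →
        H ^ (n + 1) * x ≤ (2 * d : ℝ)⁻¹ * z := by
      intro x y z h hz
      rw [le_inv_mul_iff₀ (by positivity)]
      calc 2 * d * (H ^ (n + 1) * x) = H ^ n * (2 * d * (H * x)) := by ring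
        _ ≤ H ^ n * y := by gcongr
        _ ≤ z := hz
    rw [Function.iterate_succ_apply']
    match k with
    | 0 => rw [sphereSum_wordAverage_zero]; exact key h0 (ih 1)
    | 1 =>
      rw [sphereSum_wordAverage_one]
      refine key h1 ?_
      linarith [ih 2, mul_le_mul_of_nonneg_left (ih 0) (by positivity : (0 : ℝ) ≤ 2 * d)]
    | k + 2 =>
      rw [sphereSum_wordAverage_add_two]
      refine key (h2 k) ?_
      linarith [ih (k + 3),
        mul_le_mul_of_nonneg_left (ih (k + 1)) (by linarith : (0 : ℝ) ≤ 2 * d - 1)]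

theorem sphereSum_neg (f : List (Fin d × Bool) → ℝ) (k : ℕ) :
    sphereSum (-f) k = -sphereSum f k := by
  cases k <;> simp [sphereSum]

theorem wordAverage_iterate_neg (n : ℕ) (f : List (Fin d × Bool) → ℝ) :
    wordAverage^[n] (-f) = -wordAverage^[n] f := by
  induction n with
  | zero => rfl
  | succ n ih =>
    rw [Function.iterate_succ_apply', Function.iterate_succ_apply', ih]
    funext l
    simp [wordAverage]

theorem sphereSum_le_pow_mul (hd : 2 ≤ d) (hH : 0 ≤ H) (hf : ∀ k, sphereSum f k ≤ p k)
    (h0 : p 1 ≤ 2 * d * (H * p 0)) (h1 : 2 * d * p 0 + p 2 ≤ 2 * d * (H * p 1))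
    (h2 : ∀ k, (2 * d - 1) * p (k + 1) + p (k + 3) ≤ 2 * d * (H * p (k + 2))) (n k : ℕ) :
    sphereSum (wordAverage^[n] f) k ≤ H ^ n * p k := by
  have := pow_mul_le_sphereSum (f := -f) (p := -p) hd hH
    (fun k => by simpa [sphereSum_neg] using hf k) (by simp; linarith) (by simp; linarith)
    (fun k => by simp; linarith [h2 k]) n k
  rw [wordAverage_iterate_neg, sphereSum_neg] at this
  simpa using this

end Comparison

/-! ### Gärtner–Ellis bounds -/

section GartnerEllis

variable {μ : ℕ → Measure ℝ} [∀ n, IsProbabilityMeasure (μ n)] {Λ : ℝ → ℝ}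

theorem ofReal_exp_mul_natCast (r : ℝ) (n : ℕ) :
    ENNReal.ofReal (Real.exp (n * r)) = EReal.exp ((r : EReal) * n) := by
  rw [← EReal.coe_natCast, ← EReal.coe_mul, EReal.exp_coe, mul_comm]

theorem expGrowthSup_le_of_measureReal_le {S : ℕ → Set ℝ} {C r : ℝ}
    (h : ∀ n, (μ n).real (S n) ≤ C * Real.exp (n * r)) :
    ExpGrowth.expGrowthSup (fun n => μ n (S n)) ≤ r := by
  refine (ExpGrowth.expGrowthSup_le_of_eventually_le (b := ENNReal.ofReal C)
    (v := fun n : ℕ => EReal.exp ((r : EReal) * n)) ENNReal.ofReal_ne_top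
    (Eventually.of_forall fun n => ?_)).trans_eq ExpGrowth.expGrowthSup_exp
  rw [← ofReal_exp_mul_natCast, ← ENNReal.ofReal_mul' (Real.exp_pos _).le,
    ← ofReal_measureReal]
  exact ENNReal.ofReal_le_ofReal (h n)

theorem le_expGrowthInf_of_le_measureReal {S : ℕ → Set ℝ} {c r : ℝ} (hc : 0 < c)
    (h : ∀ᶠ n : ℕ in atTop, c * Real.exp (n * r) ≤ (μ n).real (S n)) :
    r ≤ ExpGrowth.expGrowthInf (fun n => μ n (S n)) := by
  refine ExpGrowth.expGrowthInf_exp.symm.trans_le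
    (ExpGrowth.expGrowthInf_of_eventually_ge (b := ENNReal.ofReal c)
    (u := fun n : ℕ => EReal.exp ((r : EReal) * n)) (by simpa using hc)
    (h.mono fun n hn => ?_))
  rw [← ofReal_exp_mul_natCast, ← ENNReal.ofReal_mul hc.le,
    ← ofReal_measureReal]
  exact ENNReal.ofReal_le_ofReal hn

/-- The upper bound of the Gärtner–Ellis theorem, for measures on a common compact set. -/
theorem expGrowthSup_le_of_integral_exp_le {K : Set ℝ} (hK : IsCompact K)
    (hμK : ∀ n, μ n Kᶜ = 0)
    (hint : ∀ (n : ℕ) θ, Integrable (fun y => Real.exp (θ * (n * y))) (μ n))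
    (hΛ : ∀ θ, ∃ C, ∀ n : ℕ, ∫ y, Real.exp (θ * (n * y)) ∂μ n ≤ C * Real.exp (n * Λ θ))
    (Γ : Set ℝ) :
    ExpGrowth.expGrowthSup (fun n => μ n Γ) ≤
      -(⨅ x ∈ closure Γ, ⨆ θ : ℝ, ((θ * x - Λ θ : ℝ) : EReal)) := by
  by_contra! hlt
  obtain ⟨r, hr1, hr2⟩ := EReal.lt_iff_exists_real_btwn.1 hlt
  refine hr2.not_ge ?_
  have hI : ∀ x ∈ closure Γ, ∃ θ : ℝ, -r < θ * x - Λ θ := by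
    intro x hx
    have h1 : ((-r : ℝ) : EReal) < ⨅ x ∈ closure Γ, ⨆ θ : ℝ, ((θ * x - Λ θ : ℝ) : EReal) := by
      rw [EReal.coe_neg]
      exact EReal.neg_lt_comm.1 hr1
    obtain ⟨θ, hθ⟩ := lt_iSup_iff.1 (h1.trans_le (iInf₂_le x hx))
    exact ⟨θ, by exact_mod_cast hθ⟩
  obtain ⟨C, hC⟩ : ∃ C : ℝ, ∀ n : ℕ, (μ n).real (closure Γ ∩ K) ≤ C * Real.exp (n * r) := by
    -- Bounds of this form pass to subsets and finite unions, so by compactness it is enough to find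
    -- one near each point. There, Markov's inequality for `exp(θ n y)` gives it.
    refine (hK.inter_left isClosed_closure).induction_on
      (p := fun S => ∃ C : ℝ, ∀ n : ℕ, (μ n).real S ≤ C * Real.exp (n * r)) ⟨0, by simp⟩ ?_ ?_ ?_
    · rintro s t hst ⟨C, hC⟩
      exact ⟨C, fun n => (measureReal_mono hst).trans (hC n)⟩
    · rintro s t ⟨C, hC⟩ ⟨C', hC'⟩
      refine ⟨C + C', fun n => (measureReal_union_le s t).trans ?_⟩
      rw [add_mul]
      exact add_le_add (hC n) (hC' n)
    · rintro x ⟨hx, -⟩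
      obtain ⟨θ, hθ⟩ := hI x hx
      obtain ⟨C, hC⟩ := hΛ θ
      have ho : IsOpen {y : ℝ | -r < θ * y - Λ θ} := isOpen_lt (by fun_prop) (by fun_prop)
      refine ⟨_, mem_nhdsWithin_of_mem_nhds (ho.mem_nhds hθ), C, fun n => ?_⟩
      have h1 := mul_meas_ge_le_integral_of_nonneg
        (ae_of_all (μ n) fun y => (Real.exp_pos (θ * (n * y))).le) (hint n θ)
        (Real.exp (n * (Λ θ - r)))
      have h2 : (μ n).real {y : ℝ | -r < θ * y - Λ θ} ≤
          (μ n).real {y | Real.exp (n * (Λ θ - r)) ≤ Real.exp (θ * (n * y))} := by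
        refine measureReal_mono fun y hy => ?_
        simp only [Set.mem_ofPred_eq] at hy ⊢
        rw [Real.exp_le_exp, mul_left_comm]
        gcongr
        linarith
      have h3 := (mul_le_mul_of_nonneg_left h2 (Real.exp_pos (n * (Λ θ - r))).le).trans
        (h1.trans (hC n))
      rw [← le_div_iff₀' (Real.exp_pos _), mul_div_assoc, ← Real.exp_sub] at h3
      rwa [← mul_sub, sub_sub_cancel] at h3
  refine expGrowthSup_le_of_measureReal_le (C := C) fun n => ?_
  refine le_trans ?_ (hC n)
  have hsub : Γ ⊆ (closure Γ ∩ K) ∪ Kᶜ := fun x hx =>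
    (em (x ∈ K)).imp (fun h => ⟨subset_closure hx, h⟩) id
  refine (measureReal_mono hsub).trans ((measureReal_union_le _ _).trans ?_)
  simp [measureReal_def, hμK n]

/-- The local lower bound of the Gärtner–Ellis theorem, at the derivative of the limiting
logarithmic moment generating function. -/
theorem le_expGrowthInf_of_hasDerivAt
    (hint : ∀ (n : ℕ) θ, Integrable (fun y => Real.exp (θ * (n * y))) (μ n))
    (hΛ : ∀ θ, ∃ C, ∀ n : ℕ, ∫ y, Real.exp (θ * (n * y)) ∂μ n ≤ C * Real.exp (n * Λ θ))
    {θ x c : ℝ} (hc : 0 < c)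
    (hlow : ∀ n : ℕ, c * Real.exp (n * Λ θ) ≤ ∫ y, Real.exp (θ * (n * y)) ∂μ n)
    (hderiv : HasDerivAt Λ x θ) {G : Set ℝ} (hG : G ∈ 𝓝 x) :
    ((Λ θ - θ * x : ℝ) : EReal) ≤ ExpGrowth.expGrowthInf (fun n => μ n G) := by
  by_contra! hlt
  obtain ⟨r, hr1, hr2⟩ := EReal.lt_iff_exists_real_btwn.1 hlt
  refine hr1.not_ge ?_
  replace hr2 : r < Λ θ - θ * x := by exact_mod_cast hr2
  obtain ⟨ε₀, hε₀, hball⟩ := Metric.mem_nhds_iff.1 hG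
  -- On the ball, `θ y` then exceeds `θ x` by at most the available gap. The denominator `|θ| + 1`
  -- covers `θ = 0`.
  obtain ⟨ε, hε, hεε₀, hεr⟩ : ∃ ε > 0, ε ≤ ε₀ ∧ |θ| * ε ≤ Λ θ - θ * x - r := by
    have hgap : 0 < Λ θ - θ * x - r := by linarith
    refine ⟨min ε₀ ((Λ θ - θ * x - r) / (|θ| + 1)), lt_min hε₀ (by positivity), min_le_left _ _, ?_⟩
    calc |θ| * min ε₀ ((Λ θ - θ * x - r) / (|θ| + 1))
        ≤ (|θ| + 1) * ((Λ θ - θ * x - r) / (|θ| + 1)) := by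
          gcongr
          · linarith
          · exact min_le_right _ _
      _ = _ := by field_simp
  -- A one-sided slope of `Λ` below `x + ε` makes the right tail `y ≥ x + ε` exponentially
  -- negligible; the next step treats the left tail.
  obtain ⟨δ, hδ, hδΛ⟩ : ∃ δ > 0, Λ (θ + δ) - δ * (x + ε) < Λ θ := by
    have h := (hderiv.tendsto_slope_zero_right.eventually_lt_const
      (lt_add_of_pos_right x hε)).and self_mem_nhdsWithin
    obtain ⟨δ, h1, h2⟩ := h.exists
    refine ⟨δ, h2, ?_⟩
    rw [smul_eq_mul, inv_mul_lt_iff₀ h2] at h1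
    linarith
  obtain ⟨δ', hδ', hδΛ'⟩ : ∃ δ > 0, Λ (θ - δ) + δ * (x - ε) < Λ θ := by
    have h := (hderiv.tendsto_slope_zero_left.eventually_const_lt
      (sub_lt_self x hε)).and self_mem_nhdsWithin
    obtain ⟨t, h1, h2⟩ := h.exists
    replace h2 : 0 < -t := by simpa using h2
    refine ⟨-t, h2, ?_⟩
    rw [smul_eq_mul, ← neg_neg t, inv_neg, neg_mul, lt_neg, inv_mul_lt_iff₀ h2] at h1
    rw [sub_eq_add_neg]
    linarith
  obtain ⟨C, hC⟩ := hΛ (θ + δ)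
  obtain ⟨C', hC'⟩ := hΛ (θ - δ')
  -- In place of a change of measure, `exp(θ n y)` is dominated by a constant on the ball and by the
  -- exponentials with parameters `θ + δ` and `θ - δ'` on the two tails.
  have hbound : ∀ n : ℕ, c * Real.exp (n * Λ θ) ≤
      (μ n).real (Metric.ball x ε) * Real.exp (n * (θ * x + |θ| * ε)) +
      C * Real.exp (n * (Λ (θ + δ) - δ * (x + ε))) +
      C' * Real.exp (n * (Λ (θ - δ') + δ' * (x - ε))) := by
    intro n
    have hpt : ∀ y : ℝ, Real.exp (θ * (n * y)) ≤
        (Metric.ball x ε).indicator (fun _ => Real.exp (n * (θ * x + |θ| * ε))) y +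
        Real.exp ((θ + δ) * (n * y)) * Real.exp (-(n * (δ * (x + ε)))) +
        Real.exp ((θ - δ') * (n * y)) * Real.exp (n * (δ' * (x - ε))) := by
      intro y
      have hn : (0 : ℝ) ≤ n := n.cast_nonneg
      rw [← Real.exp_add, ← Real.exp_add]
      by_cases hy : y ∈ Metric.ball x ε
      · rw [Set.indicator_of_mem hy]
        have h1 : θ * (y - x) ≤ |θ| * ε := by
          refine (le_abs_self _).trans ?_
          rw [abs_mul]
          gcongr
          exact (Metric.mem_ball.1 hy).le
        have h2 : Real.exp (θ * (n * y)) ≤ Real.exp (n * (θ * x + |θ| * ε)) := by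
          rw [Real.exp_le_exp, mul_left_comm]
          gcongr
          linarith
        have := Real.exp_pos ((θ + δ) * (n * y) + -(n * (δ * (x + ε))))
        have := Real.exp_pos ((θ - δ') * (n * y) + n * (δ' * (x - ε)))
        linarith
      · rw [Set.indicator_of_notMem hy, zero_add]
        rw [Metric.mem_ball, Real.dist_eq, not_lt, le_abs] at hy
        rcases hy with hy | hy
        · have : θ * (n * y) ≤ (θ + δ) * (n * y) + -(n * (δ * (x + ε))) := by
            have : 0 ≤ n * (δ * (y - x - ε)) := by
              have : 0 ≤ y - x - ε := by linarith
              positivity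
            linarith
          exact le_add_of_le_of_nonneg (Real.exp_le_exp.2 this) (Real.exp_pos _).le
        · have : θ * (n * y) ≤ (θ - δ') * (n * y) + n * (δ' * (x - ε)) := by
            have : 0 ≤ n * (δ' * (x - y - ε)) := by
              have : 0 ≤ x - y - ε := by linarith
              positivity
            linarith
          exact le_add_of_nonneg_of_le (Real.exp_pos _).le (Real.exp_le_exp.2 this)
    have i1 : Integrable ((Metric.ball x ε).indicator
        (fun _ => Real.exp (n * (θ * x + |θ| * ε)))) (μ n) :=
      (integrable_const _).indicator Metric.isOpen_ball.measurableSet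
    have i2 := (hint n (θ + δ)).mul_const (Real.exp (-(n * (δ * (x + ε)))))
    have i3 := (hint n (θ - δ')).mul_const (Real.exp (n * (δ' * (x - ε))))
    refine (hlow n).trans ((integral_mono (hint n θ) ((i1.add i2).add i3) hpt).trans ?_)
    rw [integral_add' (i1.add i2) i3, integral_add' i1 i2,
      integral_indicator_const _ Metric.isOpen_ball.measurableSet, smul_eq_mul,
      integral_mul_const, integral_mul_const]
    have e1 : Real.exp (n * (Λ (θ + δ) - δ * (x + ε))) =
        Real.exp (n * Λ (θ + δ)) * Real.exp (-(n * (δ * (x + ε)))) := by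
      rw [← Real.exp_add]; ring_nf
    have e2 : Real.exp (n * (Λ (θ - δ') + δ' * (x - ε))) =
        Real.exp (n * Λ (θ - δ')) * Real.exp (n * (δ' * (x - ε))) := by
      rw [← Real.exp_add]; ring_nf
    rw [e1, e2, ← mul_assoc C, ← mul_assoc C']
    exact add_le_add (add_le_add le_rfl (mul_le_mul_of_nonneg_right (hC n) (Real.exp_pos _).le))
      (mul_le_mul_of_nonneg_right (hC' n) (Real.exp_pos _).le)
  have hlim : ∀ a < 0, ∀ D : ℝ, Tendsto (fun n : ℕ => D * Real.exp (n * a)) atTop (𝓝 0) := by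
    intro a ha D
    rw [← mul_zero D]
    exact (Real.tendsto_exp_atBot.comp
      (tendsto_natCast_atTop_atTop.atTop_mul_const_of_neg ha)).const_mul D
  have hsmall := ((hlim _ (sub_neg.2 hδΛ) C).add (hlim _ (sub_neg.2 hδΛ') C')).eventually_lt_const
    (show (0 : ℝ) + 0 < c / 2 by simpa using hc)
  refine le_expGrowthInf_of_le_measureReal (half_pos hc) (hsmall.mono fun n hn => ?_)
  refine le_trans ?_ (measureReal_mono ((Metric.ball_subset_ball hεε₀).trans hball))
  have h1 := hbound n
  have e : ∀ a : ℝ, Real.exp (n * a) = Real.exp (n * (a - Λ θ)) * Real.exp (n * Λ θ) := by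
    intro a; rw [← Real.exp_add]; ring_nf
  rw [e (θ * x + |θ| * ε), e (Λ (θ + δ) - _), e (Λ (θ - δ') + _)] at h1
  have h2 : c ≤ (μ n).real (Metric.ball x ε) * Real.exp (n * (θ * x + |θ| * ε - Λ θ)) +
      C * Real.exp (n * (Λ (θ + δ) - δ * (x + ε) - Λ θ)) +
      C' * Real.exp (n * (Λ (θ - δ') + δ' * (x - ε) - Λ θ)) := by
    refine le_of_mul_le_mul_right (h1.trans_eq ?_) (Real.exp_pos (n * Λ θ))
    ring
  have h3 : c / 2 ≤ (μ n).real (Metric.ball x ε) * Real.exp (n * -r) := by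
    have : Real.exp (n * (θ * x + |θ| * ε - Λ θ)) ≤ Real.exp (n * -r) := by
      gcongr; linarith
    have := mul_le_mul_of_nonneg_left this (measureReal_nonneg (μ := μ n) (s := Metric.ball x ε))
    linarith
  rw [mul_neg, Real.exp_neg, ← div_eq_mul_inv, le_div_iff₀ (Real.exp_pos _)] at h3
  exact h3

end GartnerEllis

/-! ### Growth of the moment generating function -/

/-- The sum of the weights of the letters that can follow a given one in a reduced word. -/
noncomputable def stepWeight (d : ℕ) (θ : ℝ) : ℝ := 1 + 2 * (d - 1) * Real.exp θ

section Growth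

variable {d : ℕ}

theorem one_lt_stepWeight (hd : 2 ≤ d) (θ : ℝ) : 1 < stepWeight d θ := by
  have hd' : (2 : ℝ) ≤ d := by exact_mod_cast hd
  have : 0 < 2 * ((d : ℝ) - 1) * Real.exp θ :=
    mul_pos (by linarith) (Real.exp_pos _)
  rw [stepWeight]
  linarith

theorem one_lt_sqrt (hd : 2 ≤ d) : 1 < √(2 * (d : ℝ) - 1) := by
  have hd' : (2 : ℝ) ≤ d := by exact_mod_cast hd
  exact Real.lt_sqrt_of_sq_lt (by linarith)

theorem sqrt_lt_self (hd : 2 ≤ d) : √(2 * (d : ℝ) - 1) < 2 * d - 1 := by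
  have hd' : (2 : ℝ) ≤ d := by exact_mod_cast hd
  rw [Real.sqrt_lt' (by linarith)]
  nlinarith

theorem threshold_le_iff (hd : 2 ≤ d) (θ : ℝ) :
    Real.log ((√(2 * d - 1) - 1) / (2 * (d - 1))) ≤ θ ↔ √(2 * d - 1) ≤ stepWeight d θ := by
  have hd' : (2 : ℝ) ≤ d := by exact_mod_cast hd
  have h1 : (0 : ℝ) < 2 * (d - 1) := by linarith
  have h2 := one_lt_sqrt hd
  rw [Real.log_le_iff_le_exp (div_pos (by linarith) h1), div_le_iff₀ h1, stepWeight]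
  constructor <;> intro h <;> linarith

theorem h_eq_of_le (hd : 2 ≤ d) {θ : ℝ} (hθ : √(2 * d - 1) ≤ stepWeight d θ) :
    h d θ = (stepWeight d θ + (2 * d - 1) / stepWeight d θ) / (2 * d) := by
  rw [h, if_pos ((threshold_le_iff hd θ).2 hθ), ← stepWeight]
  rw [stepWeight]
  ring

theorem h_eq_of_lt (hd : 2 ≤ d) {θ : ℝ} (hθ : stepWeight d θ < √(2 * d - 1)) :
    h d θ = √(2 * d - 1) / d := by
  rw [h, if_neg (mt (threshold_le_iff hd θ).1 hθ.not_ge)]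

theorem h_eq_of_eq (hd : 2 ≤ d) {θ : ℝ} (hθ : stepWeight d θ = √(2 * d - 1)) :
    h d θ = √(2 * d - 1) / d := by
  have hd' : (2 : ℝ) ≤ d := by exact_mod_cast hd
  rw [h_eq_of_le hd hθ.ge, hθ, Real.div_sqrt]
  ring

theorem h_pos (hd : 2 ≤ d) (θ : ℝ) : 0 < h d θ := by
  have hd' : (2 : ℝ) ≤ d := by exact_mod_cast hd
  have h1 := one_lt_stepWeight hd θ
  have h2 := one_lt_sqrt hd
  rcases le_or_gt √(2 * (d : ℝ) - 1) (stepWeight d θ) with hθ | hθ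
  · rw [h_eq_of_le hd hθ]
    have : 0 ≤ (2 * (d : ℝ) - 1) / stepWeight d θ := div_nonneg (by linarith) (by linarith)
    exact div_pos (by linarith) (by linarith)
  · rw [h_eq_of_lt hd hθ]
    exact div_pos (by linarith) (by linarith)

theorem stepWeight_log (hd : 2 ≤ d) {u : ℝ} (hu : 1 < u) :
    stepWeight d (Real.log ((u - 1) / (2 * (d - 1)))) = u := by
  have hd' : (2 : ℝ) ≤ d := by exact_mod_cast hd
  have h1 : (0 : ℝ) < 2 * (d - 1) := by linarith
  rw [stepWeight, Real.exp_log (div_pos (by linarith) h1), mul_div_cancel₀ _ h1.ne']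
  ring

theorem wordAverage_iterate_turnWeight_le_of_le (hd : 2 ≤ d) {θ : ℝ}
    (hθ : √(2 * d - 1) ≤ stepWeight d θ) :
    ∃ C, ∀ n, wordAverage^[n] (turnWeight (d := d) θ) [] ≤ C * h d θ ^ n := by
  have hd' : (2 : ℝ) ≤ d := by exact_mod_cast hd
  have hH := (h_pos hd θ).le
  have hu := one_lt_stepWeight hd θ
  have hsphere := sphereSum_turnWeight_succ (d := d) θ
  rw [← stepWeight] at hsphere
  have hhu : 2 * d * h d θ = stepWeight d θ + (2 * d - 1) / stepWeight d θ := by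
    rw [h_eq_of_le hd hθ]; field_simp
  generalize stepWeight d θ = u at *
  generalize h d θ = H at *
  obtain ⟨v, hv⟩ : ∃ v, v = (2 * (d : ℝ) - 1) / u := ⟨_, rfl⟩
  rw [← hv] at hhu
  have huv : u * v = 2 * d - 1 := by rw [hv]; field_simp
  have hv0 : 0 < v := by rw [hv]; exact div_pos (by linarith) (by linarith)
  have hu2 : 0 < u ^ 2 - 1 := by nlinarith
  -- Chosen so that the length 0 inequality holds, with slack `2d - 1 + v²`.
  obtain ⟨c, hc⟩ : ∃ c, c = 2 * d / (u ^ 2 - 1) := ⟨_, rfl⟩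
  have hc0 : 0 < c := by rw [hc]; positivity
  have hcu : c * (u ^ 2 - 1) = 2 * d := by rw [hc]; field_simp
  -- The value at length 0 that makes the length 1 equation exact.
  obtain ⟨s, hs⟩ : ∃ s, s = v + c * u := ⟨_, rfl⟩
  have hs0 : 0 < s := by rw [hs]; positivity
  -- Scaling by `C` dominates the initial data, including the weight 1 of the empty word.
  obtain ⟨C, hC⟩ : ∃ C, C = max 1 s⁻¹ := ⟨_, rfl⟩
  have hC1 : 1 ≤ C := hC ▸ le_max_left _ _
  have hCs : 1 ≤ C * s := by
    rw [← inv_le_iff_one_le_mul₀ hs0, hC]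
    exact le_max_right _ _
  have hCpos : 0 < C := by linarith
  let p : ℕ → ℝ := fun k => Nat.casesOn k (C * s) fun k => C * (2 * d * (u ^ k + c * v ^ k))
  have key := sphereSum_le_pow_mul (p := p) (f := turnWeight θ) hd hH ?_ ?_ ?_ ?_
  · exact ⟨C * s, fun n => (key n 0).trans_eq (mul_comm _ _)⟩
  · rintro (_ | k)
    · simpa [sphereSum, turnWeight, listTurns, p] using hCs
    · rw [hsphere]
      have h1 : u ^ k ≤ u ^ k + c * v ^ k := le_add_of_nonneg_right (by positivity)
      calc 2 * d * u ^ k ≤ 1 * (2 * d * (u ^ k + c * v ^ k)) := by rw [one_mul]; gcongr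
        _ ≤ C * (2 * d * (u ^ k + c * v ^ k)) := by gcongr
  · change C * (2 * d * (u ^ 0 + c * v ^ 0)) ≤ 2 * d * (H * (C * s))
    have h1 : 2 * d * (1 + c) ≤ 2 * d * H * s := by
      rw [hhu, hs]
      have h2 : (u + v) * (v + c * u) = 2 * d * (1 + c) + (2 * d - 1 + v ^ 2) := by
        linear_combination (1 + c) * huv + hcu
      rw [h2]
      exact le_add_of_nonneg_right (by nlinarith)
    have := mul_le_mul_of_nonneg_left h1 hCpos.le
    simp only [pow_zero, mul_one]
    linarith
  · change 2 * d * (C * s) + C * (2 * d * (u ^ 1 + c * v ^ 1)) ≤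
      2 * d * (H * (C * (2 * d * (u ^ 0 + c * v ^ 0))))
    have h1 : s + (u + c * v) = 2 * d * H * (1 + c) := by rw [hhu, hs]; ring
    have h2 : 2 * d * (H * (C * (2 * d * (u ^ 0 + c * v ^ 0)))) =
      2 * d * C * (2 * d * H * (1 + c)) := by ring
    rw [h2, ← h1]
    apply le_of_eq
    ring
  · intro k
    change (2 * d - 1) * (C * (2 * d * (u ^ k + c * v ^ k))) +
      C * (2 * d * (u ^ (k + 2) + c * v ^ (k + 2))) ≤
      2 * d * (H * (C * (2 * d * (u ^ (k + 1) + c * v ^ (k + 1)))))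
    have h2 : 2 * d * (H * (C * (2 * d * (u ^ (k + 1) + c * v ^ (k + 1))))) =
      2 * d * H * (C * (2 * d * (u ^ (k + 1) + c * v ^ (k + 1)))) := by ring
    rw [h2, hhu, ← huv]
    apply le_of_eq
    ring

theorem wordAverage_mono {f g : List (Fin d × Bool) → ℝ} (hfg : f ≤ g) :
    wordAverage f ≤ wordAverage g := by
  intro l
  exact mul_le_mul_of_nonneg_left (Finset.sum_le_sum fun a _ => hfg _) (by positivity)

theorem wordAverage_iterate_turnWeight_le (hd : 2 ≤ d) (θ : ℝ) :
    ∃ C, ∀ n, wordAverage^[n] (turnWeight (d := d) θ) [] ≤ C * h d θ ^ n := by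
  rcases le_or_gt √(2 * (d : ℝ) - 1) (stepWeight d θ) with hθ | hθ
  · exact wordAverage_iterate_turnWeight_le_of_le hd hθ
  -- Below the threshold `h` keeps its threshold value, and the weight increases with `θ`, so the
  -- bound at the threshold suffices.
  · have hθ₀ := stepWeight_log hd (one_lt_sqrt hd)
    set θ₀ := Real.log ((√(2 * (d : ℝ) - 1) - 1) / (2 * (d - 1))) with hdef
    have hlt : θ < θ₀ := by
      rw [← not_le, hdef, threshold_le_iff hd]
      exact hθ.not_ge
    obtain ⟨C, hC⟩ := wordAverage_iterate_turnWeight_le_of_le hd hθ₀.ge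
    refine ⟨C, fun n => ?_⟩
    rw [h_eq_of_lt hd hθ, ← h_eq_of_eq hd hθ₀]
    refine le_trans ?_ (hC n)
    have hmono : Monotone (wordAverage (d := d)) := fun _ _ => wordAverage_mono
    refine hmono.iterate n (fun l => ?_) []
    exact Real.exp_le_exp.2 (mul_le_mul_of_nonneg_right hlt.le (Nat.cast_nonneg _))

theorem le_wordAverage_iterate_turnWeight (hd : 2 ≤ d) {θ : ℝ}
    (hθ : √(2 * d - 1) < stepWeight d θ) :
    ∃ c > 0, ∀ n, c * h d θ ^ n ≤ wordAverage^[n] (turnWeight (d := d) θ) [] := by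
  have hd' : (2 : ℝ) ≤ d := by exact_mod_cast hd
  have hH := h_pos hd θ
  have hu := one_lt_stepWeight hd θ
  have hsphere := sphereSum_turnWeight_succ (d := d) θ
  rw [← stepWeight] at hsphere
  have hhu : 2 * d * h d θ = stepWeight d θ + (2 * d - 1) / stepWeight d θ := by
    rw [h_eq_of_le hd hθ.le]; field_simp
  generalize stepWeight d θ = u at *
  generalize h d θ = H at *
  obtain ⟨v, hv⟩ : ∃ v, v = (2 * (d : ℝ) - 1) / u := ⟨_, rfl⟩
  rw [← hv] at hhu
  have huv : u * v = 2 * d - 1 := by rw [hv]; field_simp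
  have hv0 : 0 < v := by rw [hv]; exact div_pos (by linarith) (by linarith)
  have hvu : v < u := by
    rw [hv, div_lt_iff₀ (by linarith), ← sq]
    exact (Real.sqrt_lt' (by linarith)).1 hθ
  -- Now `(u + v)(1 - c) = u - c v`, so the length 1 inequality holds even without its length 0
  -- term. The strict threshold inequality gives `c < 1`.
  obtain ⟨c, hc⟩ : ∃ c, c = v / u := ⟨_, rfl⟩
  have hc0 : 0 < c := by rw [hc]; exact div_pos hv0 (by linarith)
  have hc1 : c < 1 := by rw [hc, div_lt_one (by linarith)]; exact hvu
  have hcu : c * u = v := by rw [hc]; field_simp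
  -- Small enough for the length 0 inequality and for the weight 1 of the empty word; positive
  -- because `c < 1`.
  obtain ⟨s, hs⟩ : ∃ s, s = min 1 ((1 - c) / H) := ⟨_, rfl⟩
  have hs0 : 0 < s := by rw [hs]; exact lt_min one_pos (div_pos (by linarith) hH)
  have hs1 : s ≤ 1 := hs ▸ min_le_left _ _
  have hsH : H * s ≤ 1 - c := by
    rw [← le_div_iff₀' hH, hs]
    exact min_le_right _ _
  let p : ℕ → ℝ := fun k => Nat.casesOn k s fun k => 2 * d * (u ^ k - c * v ^ k)
  have key := pow_mul_le_sphereSum (p := p) (f := turnWeight θ) hd hH.le ?_ ?_ ?_ ?_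
  · exact ⟨s, hs0, fun n => (mul_comm _ _).trans_le (key n 0)⟩
  · rintro (_ | k)
    · simpa [sphereSum, turnWeight, listTurns, p] using hs1
    · rw [hsphere]
      have h1 : u ^ k - c * v ^ k ≤ u ^ k := sub_le_self _ (by positivity)
      change 2 * d * (u ^ k - c * v ^ k) ≤ 2 * d * u ^ k
      gcongr
  · change 2 * d * (H * s) ≤ 2 * d * (u ^ 0 - c * v ^ 0)
    rw [pow_zero, pow_zero, mul_one]
    gcongr
  · change 2 * d * (H * (2 * d * (u ^ 0 - c * v ^ 0))) ≤
      2 * d * s + 2 * d * (u ^ 1 - c * v ^ 1)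
    have h1 : 2 * d * (H * (2 * d * (u ^ 0 - c * v ^ 0))) =
      2 * d * (2 * d * H * (1 - c)) := by ring
    have h2 : (u + v) * (1 - c) = u ^ 1 - c * v ^ 1 := by linear_combination -hcu
    rw [h1, hhu, h2]
    have : 0 ≤ 2 * d * s := by positivity
    linarith
  · intro k
    change 2 * d * (H * (2 * d * (u ^ (k + 1) - c * v ^ (k + 1)))) ≤
      (2 * d - 1) * (2 * d * (u ^ k - c * v ^ k)) + 2 * d * (u ^ (k + 2) - c * v ^ (k + 2))
    have h2 : 2 * d * (H * (2 * d * (u ^ (k + 1) - c * v ^ (k + 1)))) =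
      2 * d * H * (2 * d * (u ^ (k + 1) - c * v ^ (k + 1))) := by ring
    rw [h2, hhu, ← huv]
    apply le_of_eq
    ring

end Growth

/-! ### Slopes of `log h` and the rate function -/

section Rate

variable {d : ℕ}

/-- The derivative of `log h` in terms of the step weight. -/
noncomputable def logGrowthSlope (d : ℕ) (u : ℝ) : ℝ :=
  (u - 1) * (u ^ 2 - (2 * d - 1)) / (u * (u ^ 2 + (2 * d - 1)))

theorem hasDerivAt_log_h (hd : 2 ≤ d) {θ : ℝ} (hθ : √(2 * d - 1) < stepWeight d θ) :
    HasDerivAt (fun θ => Real.log (h d θ)) (logGrowthSlope d (stepWeight d θ)) θ := by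
  have hd' : (2 : ℝ) ≤ d := by exact_mod_cast hd
  have hu := one_lt_stepWeight hd θ
  have hu0 : stepWeight d θ ≠ 0 := by linarith
  have hW : HasDerivAt (stepWeight d) (stepWeight d θ - 1) θ := by
    have := ((Real.hasDerivAt_exp θ).const_mul (2 * ((d : ℝ) - 1))).const_add 1
    have e : stepWeight d θ - 1 = 2 * (d - 1) * Real.exp θ := add_sub_cancel_left _ _
    rw [e]
    exact this
  have hcont : ContinuousAt (stepWeight d) θ := hW.continuousAt
  have hev : h d =ᶠ[𝓝 θ]
      fun θ => (stepWeight d θ + (2 * d - 1) / stepWeight d θ) / (2 * d) :=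
    (hcont.eventually_const_lt hθ).mono fun t ht => h_eq_of_le hd ht.le
  have hh : HasDerivAt (h d) _ θ :=
    ((hW.add ((hasDerivAt_const θ (2 * (d : ℝ) - 1)).div hW hu0)).div_const (2 * d)).congr_of_eventuallyEq
      hev
  convert hh.log (h_pos hd θ).ne' using 1
  rw [h_eq_of_le hd hθ.le, logGrowthSlope]
  have : stepWeight d θ ^ 2 + (2 * (d : ℝ) - 1) ≠ 0 := by nlinarith
  field_simp
  ring

theorem tendsto_logGrowthSlope_atTop (d : ℕ) :
    Tendsto (logGrowthSlope d) atTop (𝓝 1) := by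
  have h1 : ContinuousAt (fun t : ℝ => (1 - t) * (1 - (2 * d - 1) * t ^ 2) /
      (1 + (2 * d - 1) * t ^ 2)) 0 := by
    apply ContinuousAt.div <;> first | fun_prop | simp
  have h2 := h1.tendsto.comp tendsto_inv_atTop_zero
  simp only [sub_zero, ne_eq, OfNat.ofNat_ne_zero, not_false_eq_true, zero_pow, mul_zero, mul_one,
    add_zero, div_one] at h2
  refine h2.congr' ?_
  filter_upwards [eventually_gt_atTop 0] with u hu
  simp only [Function.comp_apply, logGrowthSlope]
  have e1 : (1 - u⁻¹) * (1 - (2 * d - 1) * u⁻¹ ^ 2) =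
    ((u - 1) * (u ^ 2 - (2 * d - 1))) / u ^ 3 := by field_simp
  have e2 : 1 + (2 * d - 1) * u⁻¹ ^ 2 = (u * (u ^ 2 + (2 * d - 1))) / u ^ 3 := by field_simp
  rw [e1, e2, div_div_div_cancel_right₀ (by positivity)]

theorem continuousAt_logGrowthSlope (hd : 2 ≤ d) {u : ℝ} (hu : 1 < u) :
    ContinuousAt (logGrowthSlope d) u := by
  have hd' : (2 : ℝ) ≤ d := by exact_mod_cast hd
  have h0 : u * (u ^ 2 + (2 * d - 1)) ≠ 0 := by
    have : 0 < 2 * (d : ℝ) - 1 := by linarith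
    positivity
  unfold logGrowthSlope
  exact ContinuousAt.div (by fun_prop) (by fun_prop) h0

theorem logGrowthSlope_sqrt (hd : 2 ≤ d) : logGrowthSlope d √(2 * d - 1) = 0 := by
  have hd' : (2 : ℝ) ≤ d := by exact_mod_cast hd
  rw [logGrowthSlope, Real.sq_sqrt (by linarith)]
  simp

theorem logGrowthSlope_nonneg (hd : 2 ≤ d) {u : ℝ} (hu : √(2 * d - 1) < u) :
    0 ≤ logGrowthSlope d u := by
  have hd' : (2 : ℝ) ≤ d := by exact_mod_cast hd
  have h1 := (one_lt_sqrt hd).trans hu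
  have h2 := (Real.sqrt_lt' (by linarith)).1 hu
  exact div_nonneg (mul_nonneg (by linarith) (by linarith))
    (mul_nonneg (by linarith) (by nlinarith))

theorem logGrowthSlope_le_one (hd : 2 ≤ d) {u : ℝ} (hu : 1 < u) : logGrowthSlope d u ≤ 1 := by
  have hd' : (2 : ℝ) ≤ d := by exact_mod_cast hd
  have h0 : 0 < 2 * (d : ℝ) - 1 := by linarith
  rw [logGrowthSlope, div_le_one (by positivity)]
  nlinarith [mul_pos h0 (sub_pos.2 hu), sq_nonneg u]

/-- Near every point of `[0, 1]` there is a derivative of `log h` that is exposed at a parameter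
where its conjugate does not exceed that of the given point. -/
theorem exists_logGrowthSlope_mem (hd : 2 ≤ d) {x : ℝ} (hx : x ∈ Set.Icc (0 : ℝ) 1) {G : Set ℝ}
    (hG : G ∈ 𝓝 x) : ∃ θ, √(2 * d - 1) < stepWeight d θ ∧
      logGrowthSlope d (stepWeight d θ) ∈ G ∧
      θ * logGrowthSlope d (stepWeight d θ) ≤ θ * x := by
  have hd' : (2 : ℝ) ≤ d := by exact_mod_cast hd
  have hd1 : (0 : ℝ) < 2 * (d - 1) := by linarith
  have hs1 := one_lt_sqrt hd
  suffices H : ∃ u, √(2 * (d : ℝ) - 1) < u ∧ logGrowthSlope d u ∈ G ∧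
      Real.log ((u - 1) / (2 * (d - 1))) * logGrowthSlope d u ≤
        Real.log ((u - 1) / (2 * (d - 1))) * x by
    obtain ⟨u, h1, h2, h3⟩ := H
    refine ⟨Real.log ((u - 1) / (2 * (d - 1))), ?_⟩
    rw [stepWeight_log hd (hs1.trans h1)]
    exact ⟨h1, h2, h3⟩
  have hcs := continuousAt_logGrowthSlope hd hs1
  -- At `x = 0`, take `u` just above `√(2d-1)`: the slope is small and nonnegative, and `u < 2d - 1`
  -- makes the parameter `θ` nonpositive.
  rcases hx.1.eq_or_lt with rfl | hx0
  · have ht : Tendsto (logGrowthSlope d) (𝓝[>] √(2 * (d : ℝ) - 1)) (𝓝 0) := by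
      have := hcs.tendsto
      rw [logGrowthSlope_sqrt hd] at this
      exact this.mono_left nhdsWithin_le_nhds
    have h1 : ∀ᶠ u : ℝ in 𝓝[>] √(2 * (d : ℝ) - 1), u < 2 * d - 1 :=
      mem_nhdsWithin_of_mem_nhds (Iio_mem_nhds (sqrt_lt_self hd))
    obtain ⟨u, ⟨hu1, hu2⟩, hu3⟩ := ((ht.eventually hG).and (h1.and self_mem_nhdsWithin)).exists.imp
      fun u h => (⟨⟨h.1, h.2.1⟩, h.2.2⟩ : (_ ∧ _) ∧ _)
    replace hu3 : √(2 * (d : ℝ) - 1) < u := hu3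
    refine ⟨u, hu3, hu1, ?_⟩
    rw [mul_zero]
    refine mul_nonpos_of_nonpos_of_nonneg ?_ (logGrowthSlope_nonneg hd hu3)
    refine Real.log_nonpos (div_nonneg (by linarith) hd1.le) ?_
    rw [div_le_one hd1]
    linarith
  · rcases hx.2.eq_or_lt with rfl | hx1
    -- At `x = 1`, take `u` large: the slope is at most 1, and `u ≥ 2d - 1` makes `θ` nonnegative.
    · obtain ⟨u, hu1, hu2, hu3⟩ := (((tendsto_logGrowthSlope_atTop d).eventually hG).and
        ((eventually_ge_atTop (2 * (d : ℝ) - 1)).and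
          (eventually_gt_atTop √(2 * (d : ℝ) - 1)))).exists
      refine ⟨u, hu3, hu1, ?_⟩
      refine mul_le_mul_of_nonneg_left (logGrowthSlope_le_one hd (hs1.trans hu3)) ?_
      refine Real.log_nonneg ?_
      rw [one_le_div hd1]
      linarith
    · obtain ⟨M, hM1, hM2⟩ := (((tendsto_logGrowthSlope_atTop d).eventually_const_lt hx1).and
        (eventually_gt_atTop √(2 * (d : ℝ) - 1))).exists
      obtain ⟨u, hu, hux⟩ := intermediate_value_Ioo hM2.le
        (fun u hu => (continuousAt_logGrowthSlope hd (hs1.trans_le hu.1)).continuousWithinAt)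
        (show x ∈ Set.Ioo _ _ from ⟨by rwa [logGrowthSlope_sqrt hd], hM1⟩)
      exact ⟨u, hu.1, hux ▸ mem_of_mem_nhds hG, hux ▸ le_rfl⟩

theorem h_le_exp (hd : 2 ≤ d) {θ : ℝ} (hθ : 0 ≤ θ) : h d θ ≤ Real.exp θ := by
  have hd' : (2 : ℝ) ≤ d := by exact_mod_cast hd
  have he : 1 ≤ Real.exp θ := Real.one_le_exp hθ
  have hu : 2 * (d : ℝ) - 1 ≤ stepWeight d θ := by
    rw [stepWeight]
    nlinarith
  have hu' : stepWeight d θ ≤ (2 * d - 1) * Real.exp θ := by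
    rw [stepWeight]
    linarith
  rw [h_eq_of_le hd ((sqrt_lt_self hd).le.trans hu), div_le_iff₀ (by positivity)]
  have : (2 * (d : ℝ) - 1) / stepWeight d θ ≤ 1 := (div_le_one (by linarith)).2 hu
  linarith

theorem h_zero (hd : 2 ≤ d) : h d 0 = 1 := by
  have hd' : (2 : ℝ) ≤ d := by exact_mod_cast hd
  have hu : stepWeight d 0 = 2 * d - 1 := by rw [stepWeight, Real.exp_zero]; ring
  rw [h_eq_of_le hd (hu ▸ (sqrt_lt_self hd).le), hu, div_self (by linarith)]
  field_simp
  ring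

theorem le_rate (d : ℕ) (x θ : ℝ) : ((θ * x - Real.log (h d θ) : ℝ) : EReal) ≤ rate d x :=
  le_iSup (fun θ : ℝ => ((θ * x - Real.log (h d θ) : ℝ) : EReal)) θ

theorem rate_nonneg (hd : 2 ≤ d) (x : ℝ) : 0 ≤ rate d x := by
  simpa [h_zero hd] using le_rate d x 0

theorem lowerSemicontinuous_rate (d : ℕ) : LowerSemicontinuous (rate d) :=
  lowerSemicontinuous_iSup fun _ =>
    (continuous_coe_real_ereal.comp (by fun_prop)).lowerSemicontinuous

/-- As `θ → -∞`, `h` is constant, so `θ x` is unbounded for `x < 0`. For `θ ≥ 0`, `log h(θ) ≤ θ`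
leaves at least `θ(x - 1)`, unbounded for `x > 1`. -/
theorem rate_eq_top (hd : 2 ≤ d) {x : ℝ} (hx : x ∉ Set.Icc (0 : ℝ) 1) : rate d x = ⊤ := by
  suffices H : ∀ B : ℝ, ∃ θ, B ≤ θ * x - Real.log (h d θ) by
    refine EReal.eq_top_iff_forall_lt _ |>.2 fun B => ?_
    obtain ⟨θ, hθ⟩ := H (B + 1)
    refine lt_of_lt_of_le ?_ (le_rate d x θ)
    exact_mod_cast (lt_add_one B).trans_le hθ
  intro B
  rw [Set.mem_Icc, not_and_or, not_le, not_le] at hx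
  rcases hx with hx | hx
  · obtain ⟨θ, h1, h2⟩ := ((tendsto_id.atBot_mul_const_of_neg hx).eventually_ge_atTop
      (B + Real.log (√(2 * d - 1) / d)) |>.and (eventually_lt_atBot
        (Real.log ((√(2 * (d : ℝ) - 1) - 1) / (2 * (d - 1)))))).exists
    refine ⟨θ, ?_⟩
    rw [h, if_neg h2.not_ge]
    simp only [id] at h1
    linarith
  · have hx' : 0 < x - 1 := by linarith
    obtain ⟨θ, h1, h2⟩ := ((tendsto_id.atTop_mul_const hx').eventually_ge_atTop B |>.and
      (eventually_ge_atTop 0)).exists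
    refine ⟨θ, ?_⟩
    have := (Real.log_le_iff_le_exp (h_pos hd θ)).2 (h_le_exp hd h2)
    simp only [id] at h1
    linarith

end Rate

/-! ### Moments of the random walk -/

/-- Dependence on finitely many letters from a finite alphabet is the source of the measurability,
integrability and independence facts below. -/
theorem exists_walk_eq {d : ℕ} (n : ℕ) :
    ∃ F : (Finset.range n → Fin d × Bool) → FreeGroup (Fin d),
      ∀ a : ℕ → Fin d × Bool, walk a n = F fun i => a i := by
  induction n with
  | zero => exact ⟨fun _ => 1, fun _ => rfl⟩
  | succ n ih =>
    obtain ⟨F, hF⟩ := ih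
    refine ⟨fun t => F (fun i => t ⟨i, Finset.mem_range.2
      ((Finset.mem_range.1 i.2).trans n.lt_succ_self)⟩) *
        letter (t ⟨n, Finset.self_mem_range_succ n⟩), fun a => ?_⟩
    rw [walk, hF]

theorem turns_le {d : ℕ} (a : ℕ → Fin d × Bool) (n : ℕ) : turns a n ≤ n := by
  refine (listTurns_le_length _).trans ?_
  change (walk a n).norm ≤ n
  induction n with
  | zero => simp [walk]
  | succ n ih =>
    refine (FreeGroup.norm_mul_le _ _).trans (add_le_add ih ?_)
    exact FreeGroup.norm_mk_le

section Moments

variable {Ω : Type*} [MeasurableSpace Ω] {P : Measure Ω}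
  {d : ℕ} {ξ : ℕ → Ω → Fin d × Bool}

theorem measurable_comp_walk {β : Type*} [MeasurableSpace β] (hmeas : ∀ i, Measurable (ξ i))
    (n : ℕ) (f : FreeGroup (Fin d) → β) :
    Measurable fun ω => f (walk (fun i => ξ i ω) n) := by
  obtain ⟨F, hF⟩ := exists_walk_eq (d := d) n
  simp only [hF]
  exact (measurable_of_finite fun t => f (F t)).comp
    (measurable_pi_lambda (fun ω (i : Finset.range n) => ξ i ω) fun i => hmeas i)

theorem integrable_comp_walk [IsProbabilityMeasure P] (hmeas : ∀ i, Measurable (ξ i))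
    (n : ℕ) (f : FreeGroup (Fin d) → ℝ) :
    Integrable (fun ω => f (walk (fun i => ξ i ω) n)) P := by
  obtain ⟨F, hF⟩ := exists_walk_eq (d := d) n
  simp only [hF]
  have hm : Measurable fun ω (i : Finset.range n) => ξ i ω :=
    measurable_pi_lambda _ fun i => hmeas i
  have := Measure.isProbabilityMeasure_map (μ := P) hm.aemeasurable
  exact (Integrable.of_finite (f := fun t => f (F t))).comp_measurable hm

theorem indepFun_walk (hmeas : ∀ i, Measurable (ξ i)) (hindep : iIndepFun ξ P)
    (n : ℕ) (f : FreeGroup (Fin d) → ℝ) (g : Fin d × Bool → ℝ) :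
    IndepFun (fun ω => f (walk (fun i => ξ i ω) n)) (fun ω => g (ξ n ω)) P := by
  obtain ⟨F, hF⟩ := exists_walk_eq (d := d) n
  simp only [hF]
  exact (hindep.indepFun_finset (Finset.range n) {n} (by simp) hmeas).comp
    (measurable_of_finite fun t => f (F t))
    (measurable_of_finite fun t : ({n} : Finset ℕ) → Fin d × Bool =>
      g (t ⟨n, Finset.mem_singleton_self n⟩))

theorem integral_walk_succ [IsProbabilityMeasure P] (hmeas : ∀ i, Measurable (ξ i)) (hindep : iIndepFun ξ P)
    (hunif : ∀ i a, P {ω | ξ i ω = a} = 1 / (2 * (d : ℝ≥0∞)))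
    (n : ℕ) (f : FreeGroup (Fin d) → ℝ) :
    ∫ ω, f (walk (fun i => ξ i ω) (n + 1)) ∂P =
      ∫ ω, rightAverage f (walk (fun i => ξ i ω) n) ∂P := by
  -- Splitting by the value of the last letter makes each term a product of independent factors.
  have hpt : ∀ ω, f (walk (fun i => ξ i ω) (n + 1)) =
      ∑ a, f (walk (fun i => ξ i ω) n * letter a) * ({a} : Set _).indicator 1 (ξ n ω) := by
    intro ω
    rw [Finset.sum_eq_single (ξ n ω) (fun a _ ha => by simp [ha.symm]) (by simp)]
    simp [walk]
  have hind : ∀ a, ∫ ω, ({a} : Set (Fin d × Bool)).indicator (1 : Fin d × Bool → ℝ) (ξ n ω) ∂P =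
      (2 * d : ℝ)⁻¹ := by
    intro a
    have h1 : (fun ω => ({a} : Set (Fin d × Bool)).indicator (1 : Fin d × Bool → ℝ) (ξ n ω)) =
        {ω | ξ n ω = a}.indicator 1 := rfl
    have h2 : MeasurableSet {ω | ξ n ω = a} := hmeas n (measurableSet_singleton a)
    rw [h1, integral_indicator_one h2, measureReal_def, hunif]
    simp
  have hmul : ∀ a, ∫ ω, f (walk (fun i => ξ i ω) n * letter a) *
      ({a} : Set (Fin d × Bool)).indicator (1 : Fin d × Bool → ℝ) (ξ n ω) ∂P =
      (2 * d : ℝ)⁻¹ * ∫ ω, f (walk (fun i => ξ i ω) n * letter a) ∂P := by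
    intro a
    rw [(indepFun_walk hmeas hindep n (fun g => f (g * letter a)) _).integral_fun_mul_eq_mul_integral
      (measurable_comp_walk hmeas n fun g => f (g * letter a)).aestronglyMeasurable
      ((measurable_of_finite _).comp (hmeas n)).aestronglyMeasurable, hind, mul_comm]
  simp only [hpt, rightAverage]
  rw [integral_finsetSum, integral_const_mul, integral_finsetSum, Finset.mul_sum]
  · exact Finset.sum_congr rfl fun a _ => hmul a
  · exact fun a _ => integrable_comp_walk hmeas n fun g => f (g * letter a)
  · intro a _
    refine (integrable_comp_walk hmeas n fun g => f (g * letter a)).mul_bdd (c := 1)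
      ((measurable_of_finite (({a} : Set (Fin d × Bool)).indicator (1 : Fin d × Bool → ℝ))).comp
        (hmeas n)).aestronglyMeasurable (ae_of_all _ fun ω => ?_)
    rw [Set.indicator_apply]
    split_ifs <;> simp

theorem integral_comp_walk [IsProbabilityMeasure P] (hmeas : ∀ i, Measurable (ξ i)) (hindep : iIndepFun ξ P)
    (hunif : ∀ i a, P {ω | ξ i ω = a} = 1 / (2 * (d : ℝ≥0∞)))
    (n : ℕ) (f : FreeGroup (Fin d) → ℝ) :
    ∫ ω, f (walk (fun i => ξ i ω) n) ∂P = rightAverage^[n] f 1 := by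
  induction n generalizing f with
  | zero => simp [walk]
  | succ n ih => rw [integral_walk_succ hmeas hindep hunif, ih, Function.iterate_succ_apply]

theorem integral_exp_turns [IsProbabilityMeasure P] (hmeas : ∀ i, Measurable (ξ i)) (hindep : iIndepFun ξ P)
    (hunif : ∀ i a, P {ω | ξ i ω = a} = 1 / (2 * (d : ℝ≥0∞))) (n : ℕ) (θ : ℝ) :
    ∫ ω, Real.exp (θ * turns (fun i => ξ i ω) n) ∂P = wordAverage^[n] (turnWeight (d := d) θ) [] := by
  have h1 := integral_comp_walk hmeas hindep hunif n fun g => turnWeight θ g.toWord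
  rw [rightAverage_iterate_one, leftAverage_iterate_toWord, FreeGroup.toWord_one] at h1
  exact h1

end Moments

end ReducedWalk

/-! ### The large deviations principle -/

theorem theorem3p1 {Ω : Type*} [MeasurableSpace Ω] (P : Measure Ω) [IsProbabilityMeasure P]
    (d : ℕ) (hd : 2 ≤ d) (ξ : ℕ → Ω → Fin d × Bool)
    (hmeas : ∀ i, Measurable (ξ i))
    (hindep : iIndepFun ξ P)
    (hunif : ∀ i a, P {ω | ξ i ω = a} = 1 / (2 * (d : ℝ≥0∞))) :
    ReducedWalk.SatisfiesLDP
      (fun n : ℕ => P.map fun ω => (ReducedWalk.turns (fun i => ξ i ω) n : ℝ) / n)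
      (ReducedWalk.rate d) := by
  have hX : ∀ n : ℕ, Measurable fun ω => (ReducedWalk.turns (fun i => ξ i ω) n : ℝ) / n :=
    fun n => ReducedWalk.measurable_comp_walk hmeas n
      fun g => (ReducedWalk.listTurns g.toWord : ℝ) / n
  have hprob : ∀ n : ℕ, IsProbabilityMeasure
      (P.map fun ω => (ReducedWalk.turns (fun i => ξ i ω) n : ℝ) / n) :=
    fun n => Measure.isProbabilityMeasure_map (hX n).aemeasurable
  have hmul : ∀ (n : ℕ) (ω : Ω), (n : ℝ) * ((ReducedWalk.turns (fun i => ξ i ω) n : ℝ) / n) =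
      ReducedWalk.turns (fun i => ξ i ω) n := by
    intro n ω
    -- At `n = 0` the quotient is `0 / 0 = 0`, and the identity survives because the empty word has
    -- no turns.
    rcases eq_or_ne n 0 with rfl | hn
    · have := ReducedWalk.turns_le (fun i => ξ i ω) 0
      simp [Nat.le_zero.1 this]
    · rw [mul_div_cancel₀ _ (Nat.cast_ne_zero.2 hn)]
  have hexp : ∀ (n : ℕ) (θ : ℝ), Measurable fun y : ℝ => Real.exp (θ * (n * y)) := by
    intro n θ; fun_prop
  have hint : ∀ (n : ℕ) (θ : ℝ), Integrable (fun y => Real.exp (θ * (n * y)))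
      (P.map fun ω => (ReducedWalk.turns (fun i => ξ i ω) n : ℝ) / n) := by
    intro n θ
    rw [integrable_map_measure (hexp n θ).aestronglyMeasurable (hX n).aemeasurable]
    exact ReducedWalk.integrable_comp_walk hmeas n
      fun g => Real.exp (θ * (n * ((ReducedWalk.listTurns g.toWord : ℝ) / n)))
  have hmgf : ∀ (n : ℕ) (θ : ℝ), ∫ y, Real.exp (θ * (n * y))
      ∂(P.map fun ω => (ReducedWalk.turns (fun i => ξ i ω) n : ℝ) / n) =
      ReducedWalk.wordAverage^[n] (ReducedWalk.turnWeight (d := d) θ) [] := by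
    intro n θ
    rw [integral_map (hX n).aemeasurable (hexp n θ).aestronglyMeasurable]
    simp only [hmul]
    exact ReducedWalk.integral_exp_turns hmeas hindep hunif n θ
  have hpow : ∀ (n : ℕ) (θ : ℝ),
      Real.exp (n * Real.log (ReducedWalk.h d θ)) = ReducedWalk.h d θ ^ n := by
    intro n θ
    rw [Real.exp_nat_mul, Real.exp_log (ReducedWalk.h_pos hd θ)]
  have hΛ : ∀ θ, ∃ C, ∀ n : ℕ, ∫ y, Real.exp (θ * (n * y))
      ∂(P.map fun ω => (ReducedWalk.turns (fun i => ξ i ω) n : ℝ) / n) ≤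
      C * Real.exp (n * Real.log (ReducedWalk.h d θ)) := by
    intro θ
    simp only [hmgf, hpow]
    exact ReducedWalk.wordAverage_iterate_turnWeight_le hd θ
  have hsupp : ∀ n : ℕ, (P.map fun ω => (ReducedWalk.turns (fun i => ξ i ω) n : ℝ) / n)
      (Set.Icc (0 : ℝ) 1)ᶜ = 0 := by
    intro n
    rw [Measure.map_apply (hX n) measurableSet_Icc.compl]
    convert measure_empty (μ := P)
    refine Set.eq_empty_of_forall_notMem fun ω hω => hω ⟨by positivity, ?_⟩
    exact div_le_one_of_le₀ (by exact_mod_cast ReducedWalk.turns_le _ n) n.cast_nonneg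
  refine ⟨ReducedWalk.rate_nonneg hd, ReducedWalk.lowerSemicontinuous_rate d, fun Γ _ => ?_,
    fun Γ _ => ReducedWalk.expGrowthSup_le_of_integral_exp_le isCompact_Icc hsupp hint hΛ Γ⟩
  rw [EReal.neg_le]
  refine le_iInf₂ fun x hx => ?_
  by_cases hx01 : x ∈ Set.Icc (0 : ℝ) 1
  · obtain ⟨θ, hθ, hG, hle⟩ :=
      ReducedWalk.exists_logGrowthSlope_mem hd hx01 (isOpen_interior.mem_nhds hx)
    obtain ⟨c, hc, hlow⟩ := ReducedWalk.le_wordAverage_iterate_turnWeight hd hθ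
    have key := ReducedWalk.le_expGrowthInf_of_hasDerivAt hint hΛ hc
      (fun n => by rw [hmgf, hpow]; exact hlow n) (ReducedWalk.hasDerivAt_log_h hd hθ)
      (mem_interior_iff_mem_nhds.1 hG)
    -- With `y` the slope at `θ`, `θ y ≤ θ x` gives `log h(θ) - θ y ≥ log h(θ) - θ x ≥ -I(x)`.
    rw [EReal.neg_le]
    refine le_trans ?_ key
    rw [EReal.neg_le]
    refine le_trans ?_ (ReducedWalk.le_rate d x θ)
    rw [← EReal.coe_neg]
    exact_mod_cast (by linarith)
  · rw [ReducedWalk.rate_eq_top hd hx01]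
    exact le_top
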